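/- Let $\mathbb K\in\{\mathbb R,\mathbb C\}$, let $X$ be a separable Banach space over $\mathbb K$ and let $(T_t)_{t\ge 0}$ be a $C_0$-semigroup of bounded linear operators on $X$ (that is, $T_0=I$, $T_{t+s}=T_tT_s$ for $t,s\ge 0$, and $t\mapsto T_tx$ is continuous on $[0,\infty)$ for every $x\in X$). A function $f:[0,\infty)\to X$ is called Pettis integrable on $[0,\infty)$ if $\varphi\circ f\in L^1([0,\infty))$ for every $\varphi\in X'$ and for every measurable $A\subset[0,\infty)$ there is $x_A\in X$ with $\varphi(x_A)=\int_A\varphi(f(t))\,dt$ for all $\varphi\in X'$. Suppose that $(T_t)_{t\ge0}$ satisfies the Frequent Hypercyclicity Criterion for semigroups (of Mangino and Peris): there are a dense subset $X_0\subset X$ and maps $S_t:X_0\to X$, $t>0$, such that for every $x\in X_0$ (i) $T_tS_tx=x$ for all $t>0$, and $T_tS_rx=S_{r-t}x$ for all $r>t>0$; (ii) $t\mapsto T_tx$ is Pettis integrable on $[0,\infty)$; (iii) $t\mapsto S_tx$ is Pettis integrable on $[0,\infty)$. Then the following hold. (a) For every $t>0$ the operator $T=T_t$ has the operator specification property (OSP):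 there is an increasing sequence $(K_n)_{n\ge1}$ of $T$-invariant subsets of $X$ (meaning $T(K_n)\subset K_n$) with $0\in K_1$ and $\overline{\bigcup_nK_n}=X$ such that for every $n\in\mathbb N$ and $\delta>0$ there is a positive integer $N=N_{\delta,n}$ such that for every integer $s\ge 2$, all $y_1,\dots,y_s\in K_n$ and all integers $0=j_1\le k_1<j_2\le k_2<\dots<j_s\le k_s$ with $j_{r+1}-k_r\ge N$ for $r=1,\dots,s-1$, there is $x\in K_n$ with $\|T^ix-T^iy_r\|<\delta$ for all $1\le r\le s$ and all integers $j_r\le i\le k_r$, and $T^{N+k_s}x=x$. (b) Consequently, the semigroup $(T_t)_{t\ge0}$ has the specification property for semigroups (SgSP): there are an increasing sequence $(K_n)_{n\ge1}$ of subsets of $X$, invariant under the semigroup (meaning $T_t(K_n)\subset K_n$ for all $t\ge0$), with $0\in K_1$ and $\overline{\bigcup_nK_n}=X$, and a number $t_0>0$, such that for every $n\in\mathbb N$ and $\delta>0$ there is a real number $M=M_{\delta,n}>0$ such that for every integer $s\ge2$, all $y_1,\dots,y_s\in K_n$ and all real numbers $0=a_1\le b_1<a_2\le b_2<\dots<a_s\le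 b_s$ with $b_s+M\in\mathbb N\cdot t_0$ and $a_{r+1}-b_r\ge M$ for $r=1,\dots,s-1$, there is $x\in K_n$ with $\|T_tx-T_ty_r\|<\delta$ for all $1\le r\le s$ and all $t\in[a_r,b_r]$, and $T_{M+b_s}x=x$. -/

import Mathlib

open MeasureTheory Set

/-- `(T t)`, `t ≥ 0`, is a `C₀`-semigroup of bounded linear operators on `X`.
The values of `T` at negative reals carry no meaning and are never used. -/
structure IsC0Semigroup {𝕜 X : Type*} [RCLike 𝕜] [NormedAddCommGroup X] [NormedSpace 𝕜 X]
    (T : ℝ → X →L[𝕜] X) : Prop where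
  map_zero : T 0 = ContinuousLinearMap.id 𝕜 X
  map_add : ∀ t s : ℝ, 0 ≤ t → 0 ≤ s → T (t + s) = (T t).comp (T s)
  continuousOn : ∀ x : X, ContinuousOn (fun t => T t x) (Ici 0)

/-- `f` is Pettis integrable with respect to `μ`: it is scalarly integrable and every measurable
set `A` has a Pettis integral `∫_A f dμ` in `X`. -/
def PettisIntegrable (𝕜 : Type*) {α X : Type*} [RCLike 𝕜] [NormedAddCommGroup X]
    [NormedSpace 𝕜 X] [MeasurableSpace α] (f : α → X) (μ : Measure α) : Prop :=
  (∀ φ : X →L[𝕜] 𝕜, Integrable (fun a => φ (f a)) μ) ∧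
    ∀ A : Set α, MeasurableSet A →
      ∃ x : X, ∀ φ : X →L[𝕜] 𝕜, φ x = ∫ a in A, φ (f a) ∂μ

/-- The Frequent Hypercyclicity Criterion for semigroups. The maps `S t` are only relevant for
`t > 0` and on the dense set `X₀`. -/
def SatisfiesFHCSemigroup {𝕜 X : Type*} [RCLike 𝕜] [NormedAddCommGroup X] [NormedSpace 𝕜 X]
    (T : ℝ → X →L[𝕜] X) : Prop :=
  ∃ (X₀ : Set X) (S : ℝ → X → X), Dense X₀ ∧
    (∀ x ∈ X₀, ∀ t : ℝ, 0 < t → T t (S t x) = x) ∧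
    (∀ x ∈ X₀, ∀ t r : ℝ, 0 < t → t < r → T t (S r x) = S (r - t) x) ∧
    (∀ x ∈ X₀, PettisIntegrable 𝕜 (fun t : ℝ => T t x) (volume.restrict (Ici 0))) ∧
    (∀ x ∈ X₀, PettisIntegrable 𝕜 (fun t : ℝ => S t x) (volume.restrict (Ici 0)))

/-- The operator specification property (OSP). Finite families are indexed by `1, …, s`. -/
def HasOSP {𝕜 X : Type*} [RCLike 𝕜] [NormedAddCommGroup X] [NormedSpace 𝕜 X]
    (T : X →L[𝕜] X) : Prop :=
  ∃ K : ℕ → Set X, Monotone K ∧ (∀ n, MapsTo T (K n) (K n)) ∧ (0 : X) ∈ K 0 ∧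
    closure (⋃ n, K n) = univ ∧
    ∀ n : ℕ, ∀ δ : ℝ, 0 < δ → ∃ N : ℕ, 0 < N ∧
      ∀ (s : ℕ) (y : ℕ → X) (j k : ℕ → ℕ), 2 ≤ s →
        (∀ r ∈ Icc 1 s, y r ∈ K n) →
        j 1 = 0 →
        (∀ r ∈ Icc 1 s, j r ≤ k r) →
        (∀ r ∈ Ico 1 s, k r < j (r + 1)) →
        (∀ r ∈ Ico 1 s, k r + N ≤ j (r + 1)) →
        ∃ x ∈ K n,
          (∀ r ∈ Icc 1 s, ∀ i ∈ Icc (j r) (k r), ‖(T ^ i) x - (T ^ i) (y r)‖ < δ) ∧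
          (T ^ (N + k s)) x = x

/-- The specification property for semigroups (SgSP). Finite families are indexed by
`1, …, s`. -/
def HasSgSP {𝕜 X : Type*} [RCLike 𝕜] [NormedAddCommGroup X] [NormedSpace 𝕜 X]
    (T : ℝ → X →L[𝕜] X) : Prop :=
  ∃ K : ℕ → Set X, Monotone K ∧ (∀ n, ∀ t : ℝ, 0 ≤ t → MapsTo (T t) (K n) (K n)) ∧
    (0 : X) ∈ K 0 ∧ closure (⋃ n, K n) = univ ∧
    ∃ t₀ : ℝ, 0 < t₀ ∧
    ∀ n : ℕ, ∀ δ : ℝ, 0 < δ → ∃ M : ℝ, 0 < M ∧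
      ∀ (s : ℕ) (y : ℕ → X) (a b : ℕ → ℝ), 2 ≤ s →
        (∀ r ∈ Icc 1 s, y r ∈ K n) →
        a 1 = 0 →
        (∀ r ∈ Icc 1 s, a r ≤ b r) →
        (∀ r ∈ Ico 1 s, b r < a (r + 1)) →
        (∃ m : ℕ, b s + M = m * t₀) →
        (∀ r ∈ Ico 1 s, M ≤ a (r + 1) - b r) →
        ∃ x ∈ K n,
          (∀ r ∈ Icc 1 s, ∀ t ∈ Icc (a r) (b r), ‖T t x - T t (y r)‖ < δ) ∧
          T (M + b s) x = x

/-!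
For `x` in the dense set `X₀` of the criterion, the two-sided orbit `g x`, with `g x s = S s x` for
`s > 0` and `g x s = T (-s) x` for `s ≤ 0`, satisfies `T t (g x s) = g x (s - t)` for `t ≥ 0`
(`map_reversedOrbit`) and is Pettis integrable on `ℝ`. Its indefinite integral `P A = ∫_A g x` is
therefore an additive function of measurable sets on which `T t` acts as the translation
`A ↦ A - t`. The averages `η⁻¹ ∫_0^η T t x dt` are values of multiples of such set functions, so
a sequence `P m` of them has values that are dense in `X` (`exists_isShiftCovariant_dense`).

The invariant sets are `K n = {∑ m < n, P m (A m)}`, with arbitrary measurable `A m`. On `K n`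
the semigroup acts by translating the sets `A m`. Hence a periodic family of sets gives a periodic
vector, and two vectors whose families agree near `t` are mapped by `T t` to families that agree
near the origin. A periodic point shadowing `y 1, …, y s` arises by cutting the families of
the `y r` down to windows around `[a r, b r]`, and by gluing and repeating the pieces
(`exists_periodic_glue`, `exists_periodic_shadowing`). All sufficiently large gap lengths are
allowed, and the same sets `K n` serve every operator `T t` and the semigroup.

What makes this work is that families agreeing near the origin give vectors that are close in
norm, that is, `‖P A‖` is uniformly small for `A` far from the origin. Pettis integrability
gives only weak countable additivity. The passage to the norm is a case of the Orlicz–Pettis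
theorem, proved here by a Baire category argument on the Cantor space that uses the separability
of `X` (`IsIndefinitePettisIntegral.exists_norm_le_of_forall_le_abs`).
-/

open Filter Topology

/-! ### Indefinite Pettis integrals have uniformly small tails -/

/-- A weakly continuous map from a Baire space to a separable normed space has small norm
oscillation on some nonempty open set: countably many balls, which are weakly closed, cover the
space, so the preimage of one of them has an interior point. -/
theorem exists_isOpen_norm_sub_le_of_weakly_continuous (𝕜 : Type*) {X Y : Type*} [RCLike 𝕜]
    [NormedAddCommGroup X] [NormedSpace 𝕜 X] [TopologicalSpace.SeparableSpace X]
    [TopologicalSpace Y] [BaireSpace Y] [Nonempty Y] {f : Y → X}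
    (hf : ∀ φ : X →L[𝕜] 𝕜, Continuous fun y => φ (f y)) {ε : ℝ} (hε : 0 < ε) :
    ∃ U : Set Y, IsOpen U ∧ U.Nonempty ∧ ∀ y ∈ U, ∀ z ∈ U, ‖f y - f z‖ ≤ ε := by
  let d := TopologicalSpace.denseSeq X
  let F : ℕ → Set Y := fun k => {y | ‖f y - d k‖ ≤ ε / 2}
  have hF : ∀ k, IsClosed (F k) := by
    intro k
    -- a closed ball is weakly closed, being cut out by the functionals of norm at most one
    have : F k = ⋂ φ : {φ : X →L[𝕜] 𝕜 // ‖φ‖ ≤ 1}, {y | ‖φ.1 (f y) - φ.1 (d k)‖ ≤ ε / 2} := by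
      ext y
      simp only [F, mem_ofPred_eq, mem_iInter]
      constructor
      · intro h φ
        rw [← map_sub]
        exact (φ.1.le_of_opNorm_le φ.2 _).trans (by simpa using h)
      · intro h
        obtain ⟨φ, hφ, hφx⟩ := exists_dual_vector'' 𝕜 (f y - d k)
        have h1 := h ⟨φ, hφ⟩
        rw [← map_sub, hφx] at h1
        simpa using h1
    rw [this]
    exact isClosed_iInter fun φ =>
      isClosed_le ((hf φ.1).sub continuous_const).norm continuous_const
  have hcov : ⋃ k, F k = univ := by
    refine eq_univ_of_forall fun y => mem_iUnion.2 ?_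
    obtain ⟨k, hk⟩ := (TopologicalSpace.denseRange_denseSeq X).exists_dist_lt (f y) (half_pos hε)
    exact ⟨k, by simpa [F, d, dist_eq_norm] using hk.le⟩
  obtain ⟨k, hk⟩ := nonempty_interior_of_iUnion_of_closed hF hcov
  refine ⟨interior (F k), isOpen_interior, hk, fun y hy z hz => ?_⟩
  have hy' : ‖f y - d k‖ ≤ ε / 2 := (interior_subset hy : y ∈ F k)
  have hz' : ‖f z - d k‖ ≤ ε / 2 := (interior_subset hz : z ∈ F k)
  calc ‖f y - f z‖ = ‖(f y - d k) - (f z - d k)‖ := by congr 1; abel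
    _ ≤ ‖f y - d k‖ + ‖f z - d k‖ := norm_sub_le _ _
    _ ≤ ε := by linarith

/-- `P` is an indefinite Pettis integral of `f : ℝ → X`, that is, `P A = ∫_A f` weakly. Only the
values of `P` at measurable sets matter. -/
def IsIndefinitePettisIntegral (𝕜 : Type*) {X : Type*} [RCLike 𝕜] [NormedAddCommGroup X]
    [NormedSpace 𝕜 X] (f : ℝ → X) (P : Set ℝ → X) : Prop :=
  (∀ φ : X →L[𝕜] 𝕜, Integrable fun s => φ (f s)) ∧
    ∀ A, MeasurableSet A → ∀ φ : X →L[𝕜] 𝕜, φ (P A) = ∫ s in A, φ (f s)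

namespace IsIndefinitePettisIntegral

variable {𝕜 X : Type*} [RCLike 𝕜] [NormedAddCommGroup X] [NormedSpace 𝕜 X]
  {f : ℝ → X} {P : Set ℝ → X}

theorem map_union (h : IsIndefinitePettisIntegral 𝕜 f P) {A B : Set ℝ} (hA : MeasurableSet A)
    (hB : MeasurableSet B) (hAB : Disjoint A B) : P (A ∪ B) = P A + P B := by
  rw [SeparatingDual.eq_iff_forall_dual_eq (R := 𝕜)]
  intro φ
  rw [map_add, h.2 _ (hA.union hB), h.2 _ hA, h.2 _ hB,
    setIntegral_union hAB hB (h.1 φ).integrableOn (h.1 φ).integrableOn]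

/-- A vector that is large in norm is detected by one functional, for which the ordinary integral
over `A` is approximated by integrals over bounded parts of `A`. -/
theorem exists_lt_norm_inter_Ioo (h : IsIndefinitePettisIntegral 𝕜 f P) {A : Set ℝ}
    (hA : MeasurableSet A) {ε : ℝ} (hε : ε < ‖P A‖) (R : ℝ) :
    ∃ L : ℝ, R < L ∧ ε < ‖P (A ∩ Ioo (-L) L)‖ := by
  obtain ⟨φ, hφ, hφx⟩ := exists_dual_vector'' 𝕜 (P A)
  have hlim : Tendsto (fun n : ℕ => ∫ s in A ∩ Ioo (-(n : ℝ)) n, φ (f s)) atTop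
      (𝓝 (∫ s in ⋃ n : ℕ, A ∩ Ioo (-(n : ℝ)) n, φ (f s))) :=
    tendsto_setIntegral_of_monotone (fun n => hA.inter measurableSet_Ioo)
      (fun m n hmn => by
        have : (m : ℝ) ≤ n := by exact_mod_cast hmn
        exact inter_subset_inter_right _ (Ioo_subset_Ioo (by linarith) this))
      (h.1 φ).integrableOn
  have hU : ⋃ n : ℕ, A ∩ Ioo (-(n : ℝ)) n = A := by
    rw [← inter_iUnion, inter_eq_left]
    intro s _
    obtain ⟨n, hn⟩ := exists_nat_gt |s|
    exact mem_iUnion.2 ⟨n, abs_lt.1 hn⟩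
  rw [hU, ← h.2 A hA, hφx] at hlim
  have hev : ∀ᶠ n : ℕ in atTop, ε < ‖∫ s in A ∩ Ioo (-(n : ℝ)) n, φ (f s)‖ :=
    hlim.norm.eventually_const_lt (by simpa using hε)
  obtain ⟨n, hn, hRn⟩ := (hev.and (tendsto_natCast_atTop_atTop.eventually_gt_atTop R)).exists
  refine ⟨n, hRn, hn.trans_le ?_⟩
  rw [← h.2 _ (hA.inter measurableSet_Ioo)]
  simpa using φ.le_of_opNorm_le hφ (P (A ∩ Ioo (-(n : ℝ)) n))

/-- The norms of the values of an indefinite Pettis integral along disjoint sets tend to zero,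
a case of the Orlicz–Pettis theorem: the map sending `J` in the Cantor space to the
value on `⋃ j ∈ J, A j` is weakly continuous, hence of small norm oscillation on some cylinder. -/
theorem exists_norm_le_of_pairwise_disjoint [TopologicalSpace.SeparableSpace X]
    (h : IsIndefinitePettisIntegral 𝕜 f P) {A : ℕ → Set ℝ} (hA : ∀ i, MeasurableSet (A i))
    (hd : Pairwise (Function.onFun Disjoint A)) {ε : ℝ} (hε : 0 < ε) :
    ∃ i, ‖P (A i)‖ ≤ ε := by
  let V : (ℕ → Bool) → Set ℝ := fun J => ⋃ i, if J i then A i else ∅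
  have hm : ∀ (J : ℕ → Bool) i, MeasurableSet (if J i then A i else ∅) := by
    intro J i; split_ifs
    exacts [hA i, MeasurableSet.empty]
  have hV : ∀ J, MeasurableSet (V J) := fun J => MeasurableSet.iUnion (hm J)
  have hcont : ∀ φ : X →L[𝕜] 𝕜, Continuous fun J => φ (P (V J)) := by
    intro φ
    have hs : Summable fun i => ‖∫ s in A i, φ (f s)‖ :=
      (hasSum_integral_iUnion hA hd (h.1 φ).integrableOn).summable.norm
    have heq : (fun J => φ (P (V J))) =
        fun J : ℕ → Bool => ∑' i, if J i then ∫ s in A i, φ (f s) else 0 := by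
      funext J
      rw [h.2 _ (hV J)]
      have := hasSum_integral_iUnion (hm J) (fun i j hij => by
        have := hd hij
        simp only [Function.onFun] at this ⊢
        split_ifs <;> simp [this]) (h.1 φ).integrableOn
      rw [← this.tsum_eq]
      congr 1; funext i
      split_ifs <;> simp
    rw [heq]
    refine continuous_tsum (fun i => ?_) hs fun i J => ?_
    · exact (continuous_of_discreteTopology
        (f := fun b : Bool => if b then ∫ s in A i, φ (f s) else 0)).comp (continuous_apply i)
    · split_ifs <;> simp
  obtain ⟨U, hU, ⟨J, hJ⟩, hosc⟩ :=
    exists_isOpen_norm_sub_le_of_weakly_continuous 𝕜 hcont hε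
  obtain ⟨I, u, hu, hIu⟩ := isOpen_pi_iff.1 hU J hJ
  obtain ⟨i, hi⟩ := Infinite.exists_notMem_finset I
  refine ⟨i, ?_⟩
  -- switching the coordinate `i` on or off stays inside the cylinder given by `I`
  have hmem : ∀ b, Function.update J i b ∈ U := fun b => hIu fun k hk => by
    have : k ≠ i := fun e => hi (e ▸ hk)
    simpa [Function.update_of_ne this] using (hu k hk).2
  have hsplit : V (Function.update J i true) = V (Function.update J i false) ∪ A i := by
    ext s
    simp only [V, mem_union, mem_iUnion]
    constructor
    · rintro ⟨k, hk⟩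
      by_cases hki : k = i
      · subst hki; right; simpa using hk
      · left; exact ⟨k, by simpa [Function.update_of_ne hki] using hk⟩
    · rintro (⟨k, hk⟩ | hs)
      · by_cases hki : k = i
        · subst hki; simp at hk
        · exact ⟨k, by simpa [Function.update_of_ne hki] using hk⟩
      · exact ⟨i, by simpa using hs⟩
  have hdisj : Disjoint (V (Function.update J i false)) (A i) := by
    simp only [V, disjoint_iUnion_left]
    intro k
    by_cases hki : k = i
    · subst hki; simp
    · have := hd hki
      split_ifs
      · exact this
      · simp
  have := hosc _ (hmem true) _ (hmem false)
  rwa [hsplit, h.map_union (hV _) (hA i) hdisj, add_sub_cancel_left] at this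

theorem exists_norm_le_of_forall_le_abs [TopologicalSpace.SeparableSpace X]
    (h : IsIndefinitePettisIntegral 𝕜 f P) {ε : ℝ} (hε : 0 < ε) :
    ∃ R : ℝ, ∀ A, MeasurableSet A → (∀ s ∈ A, R ≤ |s|) → ‖P A‖ ≤ ε := by
  by_contra! hcon
  have hstep : ∀ R : ℝ, ∃ L : ℝ, R < L ∧ ∃ A, MeasurableSet A ∧ (∀ s ∈ A, R ≤ |s| ∧ |s| < L) ∧
      ε < ‖P A‖ := by
    intro R
    obtain ⟨A, hA, hRA, hlt⟩ := hcon R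
    obtain ⟨L, hRL, hL⟩ := h.exists_lt_norm_inter_Ioo hA hlt R
    exact ⟨L, hRL, _, hA.inter measurableSet_Ioo,
      fun s hs => ⟨hRA s hs.1, abs_lt.2 hs.2⟩, hL⟩
  choose L hL A hA hRA hlt using hstep
  let ρ : ℕ → ℝ := fun k => L^[k] 0
  have hρ : ∀ k, ρ (k + 1) = L (ρ k) := fun k => Function.iterate_succ_apply' L k 0
  have hmono : Monotone ρ := monotone_nat_of_le_succ fun k => by rw [hρ]; exact (hL _).le
  obtain ⟨i, hi⟩ := h.exists_norm_le_of_pairwise_disjoint (A := fun k => A (ρ k))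
    (fun k => hA _) ((pairwise_disjoint_on _).2 fun j k hjk => by
      refine disjoint_left.2 fun s hj hk => ?_
      have h1 := (hRA _ s hj).2
      have h2 := (hRA _ s hk).1
      have h3 := hmono (Nat.succ_le_of_lt hjk)
      rw [Nat.succ_eq_add_one, hρ] at h3
      linarith) hε
  exact absurd hi (not_le.2 (hlt _))

theorem map_shift {T : ℝ → X →L[𝕜] X} (h : IsIndefinitePettisIntegral 𝕜 f P) {t : ℝ}
    (hf : ∀ s, T t (f s) = f (s - t)) {A : Set ℝ} (hA : MeasurableSet A) :
    T t (P A) = P ((· + t) ⁻¹' A) := by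
  rw [SeparatingDual.eq_iff_forall_dual_eq (R := 𝕜)]
  intro φ
  have h1 := h.2 A hA (φ.comp (T t))
  simp only [ContinuousLinearMap.comp_apply, hf] at h1
  rw [h1, h.2 _ (hA.preimage (measurable_add_const t)),
    ← (measurePreserving_add_right volume t).setIntegral_preimage_emb
      (measurableEmbedding_addRight t)]
  simp

theorem norm_sub_le_of_Icc (h : IsIndefinitePettisIntegral 𝕜 f P) {x : X} {η ε : ℝ}
    (hη : 0 ≤ η) (hx : ∀ s ∈ Icc (-η) 0, ‖f s - x‖ ≤ ε) :
    ‖P (Icc (-η) 0) - (η : 𝕜) • x‖ ≤ ε * η := by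
  obtain ⟨φ, hφ, hφx⟩ := exists_dual_vector'' 𝕜 (P (Icc (-η) 0) - (η : 𝕜) • x)
  have h1 : φ (P (Icc (-η) 0) - (η : 𝕜) • x) = ∫ s in Icc (-η) 0, φ (f s - x) := by
    simp only [map_sub]
    rw [integral_sub (h.1 φ).integrableOn (integrableOn_const (by simp)),
      h.2 _ measurableSet_Icc, setIntegral_const]
    simp [hη, Measure.real, RCLike.real_smul_eq_coe_mul]
  have h2 : ‖∫ s in Icc (-η) 0, φ (f s - x)‖ ≤ ε * volume.real (Icc (-η) 0) :=
    norm_setIntegral_le_of_norm_le_const (by simp) fun s hs =>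
      (φ.le_of_opNorm_le hφ _).trans (by simpa using hx s hs)
  rw [← h1, hφx] at h2
  simpa [Measure.real, hη] using h2

end IsIndefinitePettisIntegral

/-! ### Vector measures moved by the semigroup -/

/-- A finitely additive `X`-valued function on measurable subsets of `ℝ` on which `T t` acts as
translation by `-t` and which is uniformly small on sets far from the origin. -/
structure IsShiftCovariant {𝕜 X : Type*} [RCLike 𝕜] [NormedAddCommGroup X] [NormedSpace 𝕜 X]
    (T : ℝ → X →L[𝕜] X) (P : Set ℝ → X) : Prop where
  map_union : ∀ A B, MeasurableSet A → MeasurableSet B → Disjoint A B → P (A ∪ B) = P A + P B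
  map_shift : ∀ t, 0 ≤ t → ∀ A, MeasurableSet A → T t (P A) = P ((· + t) ⁻¹' A)
  small_at_infinity : ∀ ε : ℝ, 0 < ε →
    ∃ R : ℝ, ∀ A, MeasurableSet A → (∀ s ∈ A, R ≤ |s|) → ‖P A‖ ≤ ε

namespace IsShiftCovariant

variable {𝕜 X : Type*} [RCLike 𝕜] [NormedAddCommGroup X] [NormedSpace 𝕜 X]
  {T : ℝ → X →L[𝕜] X} {P : Set ℝ → X}

theorem map_empty (h : IsShiftCovariant T P) : P ∅ = 0 := by
  simpa using h.map_union ∅ ∅ .empty .empty (disjoint_empty _)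

theorem const_smul (h : IsShiftCovariant T P) (c : 𝕜) : IsShiftCovariant T fun A => c • P A where
  map_union A B hA hB hAB := by rw [h.map_union A B hA hB hAB, smul_add]
  map_shift t ht A hA := by rw [map_smul, h.map_shift t ht A hA]
  small_at_infinity ε hε := by
    obtain ⟨R, hR⟩ := h.small_at_infinity (ε / (‖c‖ + 1)) (by positivity)
    refine ⟨R, fun A hA hRA => ?_⟩
    rw [norm_smul]
    calc ‖c‖ * ‖P A‖ ≤ (‖c‖ + 1) * (ε / (‖c‖ + 1)) := by
          gcongr
          · linarith
          · exact hR A hA hRA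
      _ = ε := by field_simp

theorem norm_sub_le (h : IsShiftCovariant T P) {ε R : ℝ}
    (hR : ∀ A, MeasurableSet A → (∀ s ∈ A, R ≤ |s|) → ‖P A‖ ≤ ε) {A B : Set ℝ}
    (hA : MeasurableSet A) (hB : MeasurableSet B) (hAB : ∀ s, |s| < R → (s ∈ A ↔ s ∈ B)) :
    ‖P A - P B‖ ≤ 2 * ε := by
  have hsplit : ∀ {C D : Set ℝ}, MeasurableSet C → MeasurableSet D →
      P C = P (C ∩ D) + P (C \ D) := fun {C D} hC hD => by
    rw [← h.map_union _ _ (hC.inter hD) (hC.diff hD) disjoint_inf_sdiff, inter_union_sdiff]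
  have hsmall : ∀ {C D : Set ℝ}, MeasurableSet C → MeasurableSet D →
      (∀ s, |s| < R → (s ∈ C ↔ s ∈ D)) → ‖P (C \ D)‖ ≤ ε := fun hC hD hCD =>
    hR _ (hC.diff hD) fun s hs => not_lt.1 fun hlt => hs.2 ((hCD s hlt).1 hs.1)
  have h1 := hsmall hA hB hAB
  have h2 := hsmall hB hA fun s hs => (hAB s hs).symm
  rw [hsplit hA hB, hsplit hB hA, inter_comm B A, add_sub_add_left_eq_sub]
  linarith [_root_.norm_sub_le (P (A \ B)) (P (B \ A))]

end IsShiftCovariant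

/-! ### Shadowing by periodic points -/

theorem left_endpoint_nonneg {M : ℝ} (hM : 0 ≤ M) {s : ℕ} {a b : ℕ → ℝ} (ha : a 1 = 0)
    (hab : ∀ r ∈ Icc 1 s, a r ≤ b r) (hgap : ∀ r ∈ Ico 1 s, M ≤ a (r + 1) - b r) :
    ∀ r ∈ Icc 1 s, 0 ≤ a r := by
  rintro r ⟨hr1, hrs⟩
  induction r, hr1 using Nat.le_induction with
  | base => exact ha.ge
  | succ r hr ih =>
    linarith [ih (by omega), hab r ⟨hr, by omega⟩, hgap r ⟨hr, hrs⟩]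

/-- Finitely many sets `A r`, each restricted to a window around `[a r, b r]`, are glued into one
set and repeated with period `M + b s`. A gap of length at least `M` between the intervals
leaves room for a margin `M / 2` around each of them, also across the end of the period. -/
theorem exists_periodic_glue {M : ℝ} (hM : 0 < M) {s : ℕ} {a b : ℕ → ℝ} {A : ℕ → Set ℝ}
    (ha : a 1 = 0) (hab : ∀ r ∈ Icc 1 s, a r ≤ b r)
    (hgap : ∀ r ∈ Ico 1 s, M ≤ a (r + 1) - b r) (hA : ∀ r ∈ Icc 1 s, MeasurableSet (A r)) :
    ∃ U, MeasurableSet U ∧ (∀ u, u + (M + b s) ∈ U ↔ u ∈ U) ∧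
      ∀ r ∈ Icc 1 s, ∀ u ∈ Ico (a r - M / 2) (b r + M / 2), u ∈ U ↔ u ∈ A r := by
  have hlt : ∀ q r, 1 ≤ q → q < r → r ≤ s → b q + M ≤ a r := by
    intro q r hq hqr
    induction r, hqr using Nat.le_induction with
    | base => intro hr; linarith [hgap q ⟨hq, hr⟩]
    | succ r hr ih =>
      intro hrs
      have h1 := ih (by omega)
      have h2 := hab r ⟨by omega, by omega⟩
      have h3 := hgap r ⟨by omega, by omega⟩
      linarith
  have ha0 := left_endpoint_nonneg hM.le ha hab hgap
  have hbs : ∀ r ∈ Icc 1 s, b r ≤ b s := by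
    intro r hr
    rcases hr.2.eq_or_lt with h | h
    · rw [h]
    · have h1 := hlt r s hr.1 h le_rfl
      have h2 := hab s ⟨hr.1.trans hr.2, le_rfl⟩
      linarith
  let V : Set ℝ := ⋃ r ∈ Icc 1 s, A r ∩ Ico (a r - M / 2) (b r + M / 2)
  have hV : MeasurableSet V := MeasurableSet.biUnion (to_countable _)
    fun r hr => (hA r hr).inter measurableSet_Ico
  refine ⟨⋃ k : ℤ, (· + k * (M + b s)) ⁻¹' V,
    MeasurableSet.iUnion fun k => hV.preimage (measurable_add_const _), fun u => ?_,
    fun r hr u hu => ?_⟩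
  · simp only [mem_iUnion, mem_preimage]
    constructor
    · rintro ⟨k, hk⟩
      refine ⟨k + 1, ?_⟩
      convert hk using 1
      push_cast; ring
    · rintro ⟨k, hk⟩
      refine ⟨k - 1, ?_⟩
      convert hk using 1
      push_cast; ring
  · simp only [V, mem_iUnion, mem_preimage, mem_inter_iff, exists_prop]
    constructor
    · rintro ⟨k, q, hq, huA, huq⟩
      have h1 := ha0 q hq
      have h2 := ha0 r hr
      have h3 := hbs q hq
      have h4 := hbs r hr
      have hp : 0 < M + b s := by linarith [hab r hr]
      -- `u` and its translate lie in one period `[-M / 2, b s + M / 2)`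
      have hk0 : k = 0 := by
        have hk1 : (k : ℝ) < 1 := by
          by_contra! hcon
          nlinarith [huq.2, hu.1]
        have hk2 : (-1 : ℝ) < k := by
          by_contra! hcon
          nlinarith [huq.1, hu.2]
        have hk1' : k < 1 := by exact_mod_cast hk1
        have hk2' : -1 < k := by exact_mod_cast hk2
        omega
      subst hk0
      simp only [Int.cast_zero, zero_mul, add_zero] at huA huq
      rcases lt_trichotomy q r with h | h | h
      · linarith [hlt q r hq.1 h hr.2, huq.2, hu.1]
      · rwa [h] at huA
      · linarith [hlt r q hr.1 h hq.2, huq.1, hu.2]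
    · intro hA'
      exact ⟨0, r, hr, by simpa using hA', by simpa using hu⟩

/-- The set of all sums `∑ m < n, P m (A m)` over measurable sets `A m ⊆ ℝ`. -/
def sumsOfValues {X : Type*} [AddCommMonoid X] (P : ℕ → Set ℝ → X) (n : ℕ) : Set X :=
  {x | ∃ A : ℕ → Set ℝ, (∀ m, MeasurableSet (A m)) ∧ ∑ m ∈ Finset.range n, P m (A m) = x}

section sumsOfValues

variable {𝕜 X : Type*} [RCLike 𝕜] [NormedAddCommGroup X] [NormedSpace 𝕜 X]
  {T : ℝ → X →L[𝕜] X} {P : ℕ → Set ℝ → X}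

theorem monotone_sumsOfValues (hP : ∀ m, P m ∅ = 0) : Monotone (sumsOfValues P) := by
  rintro n k hnk _ ⟨A, hA, rfl⟩
  refine ⟨fun m => if m < n then A m else ∅, fun m => ?_, ?_⟩
  · dsimp only
    split_ifs
    exacts [hA m, .empty]
  · rw [← Finset.sum_subset (Finset.range_mono hnk)]
    · exact Finset.sum_congr rfl fun m hm => by simp only [if_pos (Finset.mem_range.1 hm)]
    · intro m _ hm
      simp only [if_neg (mt Finset.mem_range.2 hm), hP]

theorem map_sum_eq_sum_preimage (hP : ∀ m, IsShiftCovariant T (P m)) {t : ℝ} (ht : 0 ≤ t)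
    {A : ℕ → Set ℝ} (hA : ∀ m, MeasurableSet (A m)) (n : ℕ) :
    T t (∑ m ∈ Finset.range n, P m (A m)) =
      ∑ m ∈ Finset.range n, P m ((· + t) ⁻¹' A m) := by
  rw [map_sum]
  exact Finset.sum_congr rfl fun m _ => (hP m).map_shift t ht _ (hA m)

theorem mapsTo_sumsOfValues (hP : ∀ m, IsShiftCovariant T (P m)) (n : ℕ) {t : ℝ} (ht : 0 ≤ t) :
    MapsTo (T t) (sumsOfValues P n) (sumsOfValues P n) := by
  rintro _ ⟨A, hA, rfl⟩
  exact ⟨_, fun m => (hA m).preimage (measurable_add_const t),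
    (map_sum_eq_sum_preimage hP ht hA n).symm⟩

theorem mem_sumsOfValues_succ (hP : ∀ m, P m ∅ = 0) (n : ℕ) {A : Set ℝ} (hA : MeasurableSet A) :
    P n A ∈ sumsOfValues P (n + 1) := by
  refine ⟨fun m => if m = n then A else ∅, fun m => ?_, ?_⟩
  · dsimp only
    split_ifs
    exacts [hA, .empty]
  · rw [Finset.sum_eq_single_of_mem n (Finset.self_mem_range_succ n)]
    · simp
    · intro m _ hm
      simp [hm, hP]

/-- The specification property on `sumsOfValues P n`, with every sufficiently large number allowed
as gap length: both the discrete and the continuous property are read off from it. -/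
theorem exists_periodic_shadowing (hP : ∀ m, IsShiftCovariant T (P m)) (n : ℕ) {δ : ℝ}
    (hδ : 0 < δ) :
    ∃ M₀ : ℝ, 0 < M₀ ∧ ∀ M, M₀ ≤ M → ∀ (s : ℕ) (y : ℕ → X) (a b : ℕ → ℝ), 1 ≤ s →
      (∀ r ∈ Icc 1 s, y r ∈ sumsOfValues P n) → a 1 = 0 → (∀ r ∈ Icc 1 s, a r ≤ b r) →
      (∀ r ∈ Ico 1 s, M ≤ a (r + 1) - b r) →
      ∃ x ∈ sumsOfValues P n,
        (∀ r ∈ Icc 1 s, ∀ t ∈ Icc (a r) (b r), ‖T t x - T t (y r)‖ < δ) ∧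
        T (M + b s) x = x := by
  have hε : 0 < δ / (2 * (n + 1)) := by positivity
  choose R hR using fun m => (hP m).small_at_infinity _ hε
  -- one margin that serves all `m < n`
  obtain ⟨R₀, hR₀⟩ := ((Finset.range n).image R).exists_le
  have hR₀' : ∀ m ∈ Finset.range n, R m ≤ R₀ := fun m hm => hR₀ _ (Finset.mem_image_of_mem R hm)
  refine ⟨2 * max R₀ 1, by positivity, fun M hM s y a b hs hy ha hab hgap => ?_⟩
  have hM1 : 0 < M := lt_of_lt_of_le (by positivity) hM
  have ha0 := left_endpoint_nonneg hM1.le ha hab hgap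
  have hMR : R₀ ≤ M / 2 := by linarith [le_max_left R₀ 1]
  choose! A hA hAy using hy
  choose U hU hUp hUA using fun m => exists_periodic_glue (A := fun r => A r m) hM1 ha hab hgap
    fun r hr => hA r hr m
  refine ⟨∑ m ∈ Finset.range n, P m (U m), ⟨U, hU, rfl⟩, fun r hr t ht => ?_, ?_⟩
  · have ht0 : 0 ≤ t := (ha0 r hr).trans ht.1
    rw [← hAy r hr, map_sum_eq_sum_preimage hP ht0 hU,
      map_sum_eq_sum_preimage hP ht0 (hA r hr), ← Finset.sum_sub_distrib]
    calc ‖∑ m ∈ Finset.range n, (P m ((· + t) ⁻¹' U m) - P m ((· + t) ⁻¹' A r m))‖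
        ≤ ∑ _m ∈ Finset.range n, 2 * (δ / (2 * (n + 1))) := by
          refine norm_sum_le_of_le _ fun m hm => ?_
          refine (hP m).norm_sub_le (R := R m) (hR m) ((hU m).preimage (measurable_add_const t))
            ((hA r hr m).preimage (measurable_add_const t)) fun u hu => ?_
          have h1 := abs_lt.1 hu
          have h2 := hR₀' m hm
          exact hUA m r hr (u + t) ⟨by linarith [ht.1], by linarith [ht.2]⟩
      _ = δ * (n / (n + 1)) := by
          rw [Finset.sum_const, Finset.card_range, nsmul_eq_mul]; field_simp
      _ < δ * 1 := by
          gcongr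
          rw [div_lt_one (by positivity)]; linarith
      _ = δ := mul_one δ
  · have hp : 0 ≤ M + b s := by linarith [ha0 s ⟨hs, le_rfl⟩, hab s ⟨hs, le_rfl⟩]
    rw [map_sum_eq_sum_preimage hP hp hU]
    refine Finset.sum_congr rfl fun m _ => congrArg (P m) ?_
    ext u
    exact hUp m u

end sumsOfValues

/-! ### The criterion supplies the vector measures -/

section Criterion

variable {𝕜 X : Type*} [RCLike 𝕜] [NormedAddCommGroup X] [NormedSpace 𝕜 X]
  {T : ℝ → X →L[𝕜] X}

theorem IsC0Semigroup.pow_eq (hT : IsC0Semigroup T) {t : ℝ} (ht : 0 ≤ t) (i : ℕ) :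
    T t ^ i = T (i * t) := by
  induction i with
  | zero => rw [pow_zero, Nat.cast_zero, zero_mul, hT.map_zero]; rfl
  | succ i ih =>
    rw [pow_succ, ih, Nat.cast_succ, add_mul, one_mul, hT.map_add _ _ (by positivity) ht]
    rfl

/-- The two-sided orbit of `x` with reversed time: `S s x` for `s > 0` and `T (-s) x` for
`s ≤ 0`, so that `T t` translates it by `t`. -/
noncomputable def reversedOrbit (T : ℝ → X →L[𝕜] X) (S : ℝ → X → X) (x : X) (s : ℝ) : X :=
  if 0 < s then S s x else T (-s) x

theorem map_reversedOrbit (hT : IsC0Semigroup T) {S : ℝ → X → X} {x : X}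
    (hTS : ∀ t : ℝ, 0 < t → T t (S t x) = x)
    (hTS' : ∀ t r : ℝ, 0 < t → t < r → T t (S r x) = S (r - t) x) {t : ℝ} (ht : 0 ≤ t) (s : ℝ) :
    T t (reversedOrbit T S x s) = reversedOrbit T S x (s - t) := by
  rcases ht.eq_or_lt with rfl | ht0
  · simp [hT.map_zero]
  unfold reversedOrbit
  by_cases hs : 0 < s
  · rw [if_pos hs]
    rcases lt_trichotomy t s with h | rfl | h
    · rw [if_pos (by linarith), hTS' t s ht0 h]
    · rw [if_neg (by simp), hTS t ht0]
      simp [hT.map_zero]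
    · have : T t = (T (t - s)).comp (T s) := by
        rw [← hT.map_add _ _ (by linarith) hs.le]; ring_nf
      rw [if_neg (by linarith), this, ContinuousLinearMap.comp_apply, hTS s hs, neg_sub]
  · rw [if_neg hs, if_neg (by linarith), ← ContinuousLinearMap.comp_apply,
      ← hT.map_add _ _ ht (by linarith)]
    congr 2; ring

theorem exists_isIndefinitePettisIntegral_reversedOrbit {S : ℝ → X → X} {x : X}
    (hTx : PettisIntegrable 𝕜 (fun t : ℝ => T t x) (volume.restrict (Ici 0)))
    (hSx : PettisIntegrable 𝕜 (fun t : ℝ => S t x) (volume.restrict (Ici 0))) :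
    ∃ P, IsIndefinitePettisIntegral 𝕜 (reversedOrbit T S x) P := by
  have hpos : EqOn (reversedOrbit T S x) (fun s => S s x) (Ioi 0) := fun s hs => if_pos hs
  have hneg : EqOn (reversedOrbit T S x) (fun s => T (-s) x) (Iic 0) :=
    fun s hs => if_neg (not_lt.2 hs)
  have hi1 : ∀ φ : X →L[𝕜] 𝕜, IntegrableOn (fun s => φ (reversedOrbit T S x s)) (Ioi 0) := by
    intro φ
    have h1 : IntegrableOn (fun s => φ (S s x)) (Ioi 0) :=
      IntegrableOn.mono_set (t := Ici 0) (hSx.1 φ) Ioi_subset_Ici_self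
    exact h1.congr_fun (fun s hs => by simp only [hpos hs]) measurableSet_Ioi
  have hi2 : ∀ φ : X →L[𝕜] 𝕜, IntegrableOn (fun s => φ (reversedOrbit T S x s)) (Iic 0) := by
    intro φ
    have h1 : IntegrableOn ((fun s => φ (T s x)) ∘ Neg.neg) (Neg.neg ⁻¹' Ici (0 : ℝ)) :=
      ((Measure.measurePreserving_neg volume).integrableOn_comp_preimage
        (Homeomorph.neg ℝ).measurableEmbedding).2 (hTx.1 φ)
    simp only [neg_preimage, neg_Ici, neg_zero] at h1
    exact h1.congr_fun (fun s hs => by simp only [hneg hs, Function.comp]) measurableSet_Iic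
  have hi : ∀ φ : X →L[𝕜] 𝕜, Integrable fun s => φ (reversedOrbit T S x s) := fun φ => by
    rw [← integrableOn_univ, ← Iic_union_Ioi (a := (0 : ℝ))]
    exact (hi2 φ).union (hi1 φ)
  have hex : ∀ A : Set ℝ, ∃ z : X, MeasurableSet A →
      ∀ φ : X →L[𝕜] 𝕜, φ z = ∫ s in A, φ (reversedOrbit T S x s) := by
    intro A
    by_cases hA : MeasurableSet A
    swap
    · exact ⟨0, fun h => absurd h hA⟩
    obtain ⟨u, hu⟩ := hTx.2 (Neg.neg ⁻¹' A) (hA.preimage measurable_neg)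
    obtain ⟨v, hv⟩ := hSx.2 (A ∩ Ioi 0) (hA.inter measurableSet_Ioi)
    refine ⟨u + v, fun _ φ => ?_⟩
    have h1 : φ u = ∫ s in A ∩ Iic 0, φ (reversedOrbit T S x s) := by
      rw [hu φ, Measure.restrict_restrict (hA.preimage measurable_neg)]
      have : Neg.neg ⁻¹' (Neg.neg ⁻¹' A ∩ Ici (0 : ℝ)) = A ∩ Iic 0 := by
        ext s; simp
      rw [← (Measure.measurePreserving_neg volume).setIntegral_preimage_emb
        (Homeomorph.neg ℝ).measurableEmbedding, this]
      exact setIntegral_congr_fun (hA.inter measurableSet_Iic)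
        fun s hs => by simp only [hneg hs.2]
    have h2 : φ v = ∫ s in A ∩ Ioi 0, φ (reversedOrbit T S x s) := by
      rw [hv φ, Measure.restrict_restrict (hA.inter measurableSet_Ioi), inter_assoc,
        inter_eq_left.2 Ioi_subset_Ici_self]
      exact setIntegral_congr_fun (hA.inter measurableSet_Ioi)
        fun s hs => by simp only [hpos hs.2]
    rw [map_add, h1, h2, ← setIntegral_union
      (Disjoint.mono inter_subset_right inter_subset_right (Iic_disjoint_Ioi le_rfl))
      (hA.inter measurableSet_Ioi) (hi φ).integrableOn (hi φ).integrableOn,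
      ← inter_union_distrib_left, Iic_union_Ioi, inter_univ]
  choose P hP using hex
  exact ⟨P, hi, hP⟩

/-- The averages `η⁻¹ ∫_0^η T t x dt`, which are values of the vector measure of the orbit of `x`
scaled by `η⁻¹`, tend to `x` as `η → 0`. Values `η = 1 / (k + 1)` and countably many `x`
suffice. -/
theorem exists_isShiftCovariant_dense [TopologicalSpace.SeparableSpace X]
    (hT : IsC0Semigroup T) (hFHC : SatisfiesFHCSemigroup T) :
    ∃ P : ℕ → Set ℝ → X, (∀ m, IsShiftCovariant T (P m)) ∧
      Dense {x | ∃ m A, MeasurableSet A ∧ P m A = x} := by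
  obtain ⟨X₀, S, hX₀, hTS, hTS', hTint, hSint⟩ := hFHC
  have : TopologicalSpace.SeparableSpace X₀ :=
    (TopologicalSpace.IsSeparable.of_separableSpace X₀).separableSpace
  have : Nonempty X₀ := hX₀.nonempty.to_subtype
  obtain ⟨d, hd⟩ := TopologicalSpace.exists_dense_seq X₀
  have hd' : DenseRange fun i => (d i : X) :=
    hX₀.denseRange_val.comp hd continuous_subtype_val
  choose Q hQ using fun i =>
    exists_isIndefinitePettisIntegral_reversedOrbit (hTint _ (d i).2) (hSint _ (d i).2)
  have hQ' : ∀ i, IsShiftCovariant T (Q i) := fun i =>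
    { map_union := fun A B hA hB hAB => (hQ i).map_union hA hB hAB
      map_shift := fun t ht A hA => (hQ i).map_shift
        (map_reversedOrbit hT (hTS _ (d i).2) (hTS' _ (d i).2) ht) hA
      small_at_infinity := fun ε hε => (hQ i).exists_norm_le_of_forall_le_abs hε }
  -- the index `m` encodes a point of the dense sequence and a scaling factor
  refine ⟨fun m A => ((m.unpair.2 + 1 : ℕ) : 𝕜) • Q m.unpair.1 A, fun m => (hQ' _).const_smul _,
    Metric.dense_iff.2 fun x ε hε => ?_⟩
  obtain ⟨i, hi⟩ := hd'.exists_dist_lt x (half_pos hε)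
  have hcont : Tendsto (fun t => T t (d i)) (𝓝[Ici 0] 0) (𝓝 (T 0 (d i))) :=
    hT.continuousOn (d i) 0 self_mem_Ici
  obtain ⟨η, hη, hηT⟩ := Metric.mem_nhdsWithin_iff.1
    (hcont (Metric.closedBall_mem_nhds _ (half_pos (half_pos hε))))
  obtain ⟨k, hk⟩ := exists_nat_one_div_lt hη
  have hk1 : (0 : ℝ) < k + 1 := by positivity
  have hclose : ∀ s ∈ Icc (-(1 / (k + 1 : ℝ))) 0,
      ‖reversedOrbit T S (d i) s - d i‖ ≤ ε / 2 / 2 := by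
    intro s hs
    have h1 : -s ∈ Metric.ball (0 : ℝ) η ∩ Ici 0 := by
      refine ⟨?_, by simpa using hs.2⟩
      rw [mem_ball_zero_iff, Real.norm_eq_abs, abs_neg, abs_of_nonpos hs.2]
      linarith [hs.1]
    have h2 := hηT h1
    rw [mem_preimage, Metric.mem_closedBall, dist_eq_norm, hT.map_zero] at h2
    simpa [reversedOrbit, not_lt.2 hs.2] using h2
  have hbound := (hQ i).norm_sub_le_of_Icc (by positivity) hclose
  refine ⟨_, ?_, Nat.pair i k, _, measurableSet_Icc (a := -(1 / (k + 1 : ℝ))) (b := 0), rfl⟩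
  simp only [Nat.unpair_pair]
  set v := Q i (Icc (-(1 / (k + 1 : ℝ))) 0)
  have hk𝕜 : ((k : 𝕜) + 1) ≠ 0 := by exact_mod_cast k.succ_ne_zero
  have hnorm : ‖((k + 1 : ℕ) : 𝕜) • v - d i‖ ≤ ε / 2 / 2 := by
    have heq : ((k + 1 : ℕ) : 𝕜) • v - d i =
        ((k + 1 : ℕ) : 𝕜) • (v - ((1 / (k + 1 : ℝ) : ℝ) : 𝕜) • (d i : X)) := by
      rw [smul_sub, smul_smul]
      congr 1
      push_cast
      rw [mul_one_div_cancel hk𝕜, one_smul]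
    rw [heq, norm_smul, RCLike.norm_natCast]
    calc ((k + 1 : ℕ) : ℝ) * ‖v - ((1 / (k + 1 : ℝ) : ℝ) : 𝕜) • (d i : X)‖
        ≤ ((k + 1 : ℕ) : ℝ) * (ε / 2 / 2 * (1 / (k + 1))) := by gcongr
      _ = ε / 2 / 2 := by push_cast; field_simp
  rw [Metric.mem_ball, dist_comm]
  calc dist x (((k + 1 : ℕ) : 𝕜) • v)
      ≤ dist x (d i) + dist (d i : X) (((k + 1 : ℕ) : 𝕜) • v) := dist_triangle _ _ _
    _ < ε := by
      rw [dist_comm (d i : X) (_ • v), dist_eq_norm (_ • v)]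
      linarith

end Criterion

theorem mainTheorem3 {𝕜 X : Type*} [RCLike 𝕜] [NormedAddCommGroup X] [NormedSpace 𝕜 X]
    [CompleteSpace X] [TopologicalSpace.SeparableSpace X]
    (T : ℝ → X →L[𝕜] X) (hT : IsC0Semigroup T) (hFHC : SatisfiesFHCSemigroup T) :
    (∀ t : ℝ, 0 < t → HasOSP (T t)) ∧ HasSgSP T := by
  obtain ⟨P, hP, hdense⟩ := exists_isShiftCovariant_dense hT hFHC
  have hP0 : ∀ m, P m ∅ = 0 := fun m => (hP m).map_empty
  have hzero : (0 : X) ∈ sumsOfValues P 0 := ⟨fun _ => ∅, fun _ => .empty, by simp⟩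
  have hclosure : closure (⋃ n, sumsOfValues P n) = univ := by
    refine (hdense.mono ?_).closure_eq
    rintro _ ⟨m, A, hA, rfl⟩
    exact mem_iUnion.2 ⟨m + 1, mem_sumsOfValues_succ hP0 m hA⟩
  refine ⟨fun t ht => ⟨sumsOfValues P, monotone_sumsOfValues hP0,
    fun n => mapsTo_sumsOfValues hP n ht.le, hzero, hclosure, fun n δ hδ => ?_⟩,
    sumsOfValues P, monotone_sumsOfValues hP0, fun n t ht => mapsTo_sumsOfValues hP n ht, hzero,
    hclosure, 1, one_pos, fun n δ hδ => ?_⟩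
  · obtain ⟨M₀, hM₀, hspec⟩ := exists_periodic_shadowing hP n hδ
    obtain ⟨N, hN⟩ := exists_nat_gt (M₀ / t)
    have hN0 : 0 < N := by exact_mod_cast (div_pos hM₀ ht).trans hN
    refine ⟨N, hN0, fun s y j k hs hy hj hjk _ hgap => ?_⟩
    obtain ⟨x, hx, hshadow, hper⟩ := hspec (N * t) ((div_lt_iff₀ ht).1 hN).le s y
      (fun r => j r * t) (fun r => k r * t) (by omega) hy (by simp [hj])
      (fun r hr => by have := hjk r hr; gcongr)
      (fun r hr => by
        have h1 : (k r : ℝ) + N ≤ j (r + 1) := by exact_mod_cast hgap r hr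
        nlinarith)
    refine ⟨x, hx, fun r hr i hi => ?_, ?_⟩
    · rw [hT.pow_eq ht.le]
      exact hshadow r hr (i * t) ⟨by have := hi.1; gcongr, by have := hi.2; gcongr⟩
    · rw [hT.pow_eq ht.le, Nat.cast_add, add_mul]
      exact hper
  · obtain ⟨M, hM, hspec⟩ := exists_periodic_shadowing hP n hδ
    exact ⟨M, hM, fun s y a b hs hy ha hab _ _ hgap =>
      hspec M le_rfl s y a b (by omega) hy ha hab hgap⟩
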